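/- Let $\mathcal S,\mathcal A$ be finite sets and let $\mathcal M_f=(\mathcal S,\mathcal A,p,p_0,f)$ be an average general-utility Markov decision process: $p(\cdot\mid s,a)$ is a probability distribution on $\mathcal S$ for every $(s,a)\in\mathcal S\times\mathcal A$, $p_0$ is a probability distribution on $\mathcal S$, and $f:\Delta(\mathcal S\times\mathcal A)\to\mathbb R$ is a function on the probability simplex. Suppose that $f$ is $c$-strongly convex with respect to the Euclidean norm for some $c>0$, i.e. $$f(\lambda d_1+(1-\lambda)d_2)\le \lambda f(d_1)+(1-\lambda)f(d_2)-\tfrac c2\lambda(1-\lambda)\|d_1-d_2\|_2^2$$ for all $d_1,d_2\in\Delta(\mathcal S\times\mathcal A)$ and $\lambda\in[0,1]$ (for differentiable $f$ this is $f(d_1)\ge f(d_2)+\nabla f(d_2)^\top(d_1-d_2)+\frac c2\|d_1-d_2\|_2^2$). Let $\pi=\pi(\cdot\mid s)$ be a stationary policy, and let $\zeta_\pi$ be the law of the trajectory $T=(S_0,A_0,S_1,A_1,\dots)$ with $S_0\sim p_0$, $A_t\sim\pi(\cdot\mid S_t)$, $S_{t+1}\sim p(\cdot\mid S_t,A_t)$.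 For an integer $K\ge1$ let $T_1,\dots,T_K$ be independent with law $\zeta_\pi$, $T_k=(S_{k,0},A_{k,0},S_{k,1},A_{k,1},\dots)$, and put $$\hat d_{\mathcal T_K}(s,a)=\frac1K\sum_{k=1}^K\lim_{H\to\infty}\frac1H\sum_{t=0}^{H-1}\mathbf 1(S_{k,t}=s,A_{k,t}=a),\qquad d_\pi(s,a)=\lim_{H\to\infty}\frac1H\sum_{t=0}^{H-1}\mathbb P(S_t=s,A_t=a),$$ $$f_K(\pi)=\mathbb E\big[f(\hat d_{\mathcal T_K})\big],\qquad f_\infty(\pi)=f(d_\pi).$$ Consider the Markov chain on $\mathcal S$ with transition matrix $P^\pi(s,s')=\sum_a\pi(a\mid s)p(s'\mid s,a)$ and initial distribution $p_0$. Let $\mathcal R_1,\dots,\mathcal R_L$ be its recurrent classes (the communicating classes all of whose states are recurrent, a state being recurrent if the chain started there returns to it with probability one), let $\mu_l$ be the stationary distribution of $P^\pi$ carried by $\mathcal R_l$, and let $\alpha_l=\lim_{t\to\infty}\mathbb P(S_t\in\mathcal R_l\mid S_0\sim p_0)$ be the probability of absorption into $\mathcal R_l$. Then all these objects are well defined (each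 $\mu_l$ exists and is unique, the limits defining $d_\pi$ and $\alpha_l$ exist, the limits defining $\hat d_{\mathcal T_K}$ exist almost surely, and $f(\hat d_{\mathcal T_K})$ is integrable), and $$f_K(\pi)-f_\infty(\pi)\;\ge\;\frac{c}{2K}\sum_{l=1}^L\alpha_l(1-\alpha_l)\sum_{s\in\mathcal R_l}\sum_{a\in\mathcal A}\pi(a\mid s)^2\,\mu_l(s)^2 .$$ -/

import Mathlib

open MeasureTheory ProbabilityTheory Filter Topology

noncomputable section

/-! ### Finite Markov chains -/

section MarkovChain

variable {X : Type*} [Fintype X] [MeasurableSpace X] [MeasurableSingletonClass X]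

/-- The transition kernel from the history up to time `n` to the state at time `n + 1`,
for the time-homogeneous Markov chain with transition probabilities `P x y`. -/
def markovStep (P : X → PMF X) (n : ℕ) : Kernel (Finset.Iic n → X) X :=
  Kernel.ofFunOfCountable fun h => (P (h ⟨n, Finset.mem_Iic.2 le_rfl⟩)).toMeasure

instance markovStep.instIsMarkovKernel (P : X → PMF X) (n : ℕ) :
    IsMarkovKernel (markovStep P n) :=
  ⟨fun h => PMF.toMeasure.isProbabilityMeasure (P (h ⟨n, Finset.mem_Iic.2 le_rfl⟩))⟩

/-- The law on `ℕ → X` of the Markov chain with initial distribution `ν` and transition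
probabilities `P`. -/
def markovLaw (ν : PMF X) (P : X → PMF X) : Measure (ℕ → X) :=
  Kernel.trajMeasure (X := fun _ => X) ν.toMeasure (markovStep P)

/-- A state is recurrent if the chain started there returns to it with probability one. -/
def IsRecurrentState (P : X → PMF X) (x : X) : Prop :=
  markovLaw (PMF.pure x) P {ω | ∃ t : ℕ, 1 ≤ t ∧ ω t = x} = 1

/-- `y` is reachable from `x` through finitely many (possibly zero) steps of positive
probability. -/
def Reaches (P : X → PMF X) : X → X → Prop :=
  Relation.ReflTransGen fun x y => P x y ≠ 0

/-- A recurrent class: a communicating class all of whose states are recurrent. -/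
def IsRecurrentClass (P : X → PMF X) (R : Finset X) : Prop :=
  (∃ x, ∀ y, y ∈ R ↔ Reaches P x y ∧ Reaches P y x) ∧ ∀ y ∈ R, IsRecurrentState P y

open Classical in
/-- The finite set `{R₁, …, R_L}` of all recurrent classes. -/
def recurrentClasses (P : X → PMF X) : Finset (Finset X) :=
  Finset.univ.filter (IsRecurrentClass P)

/-- `μ` is a stationary distribution of the chain that is carried by `R`. -/
def IsStationaryOn (P : X → PMF X) (R : Finset X) (μ : PMF X) : Prop :=
  μ.bind P = μ ∧ ∀ x, x ∉ R → μ x = 0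

/-- `ℙ(S_t ∈ R)` for the chain with initial distribution `ν`. -/
def probIn (ν : PMF X) (P : X → PMF X) (R : Finset X) (t : ℕ) : ℝ :=
  (markovLaw ν P).real {ω | ω t ∈ R}

/-- The absorption probability `lim_{t → ∞} ℙ(S_t ∈ R)`. -/
def absorptionProb (ν : PMF X) (P : X → PMF X) (R : Finset X) : ℝ :=
  limUnder atTop (probIn ν P R)

end MarkovChain

/-! ### General-utility Markov decision processes -/

/-- The set of probability vectors over `X`, as a subset of Euclidean space. -/
def probSimplex (X : Type*) [Fintype X] : Set (EuclideanSpace ℝ X) :=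
  {d | (fun x => d x) ∈ stdSimplex ℝ X}

/-- A general-utility Markov decision process with state space `S` and action space `A`.
Only the values of `utility` on the simplex `probSimplex (S × A)` are meaningful. -/
structure GUMDP (S A : Type*) [Fintype S] [Fintype A] where
  /-- `trans s a s'` is the probability of moving to `s'` after playing `a` in `s`. -/
  trans : S → A → PMF S
  /-- The distribution of the initial state. -/
  init : PMF S
  /-- The objective `f`, a function of a state-action occupancy. -/
  utility : EuclideanSpace ℝ (S × A) → ℝ

section Empirical

variable {X : Type*}

/-- `(1 / H) ∑_{t < H} 1(τ_t = x)`. -/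
def empFreq (τ : ℕ → X) (x : X) (H : ℕ) : ℝ :=
  (1 / (H : ℝ)) * ∑ t ∈ Finset.range H, Set.indicator {x} (fun _ => (1 : ℝ)) (τ t)

/-- The empirical average occupancy of one infinite trajectory. -/
def empOcc (τ : ℕ → X) (x : X) : ℝ :=
  limUnder atTop (empFreq τ x)

/-- The empirical average occupancy of `K` infinite trajectories. -/
def empOccTrials [Fintype X] {K : ℕ} (T : Fin K → ℕ → X) : EuclideanSpace ℝ X :=
  WithLp.toLp 2 fun x => (1 / (K : ℝ)) * ∑ k, empOcc (T k) x

end Empirical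

namespace GUMDP

variable {S A : Type*} [Fintype S] [Fintype A]

/-- The transition matrix `P^π(s, s') = ∑ a, π(a|s) p(s'|s, a)` of the stationary policy `π`. -/
def policyKernel (M : GUMDP S A) (π : S → PMF A) (s : S) : PMF S :=
  (π s).bind (M.trans s)

/-- The distribution of `(s, a)` when `s` has distribution `ν` and `a` is drawn from `π(·|s)`. -/
def withAction (π : S → PMF A) (ν : PMF S) : PMF (S × A) :=
  ν.bind fun s => (π s).map fun a => (s, a)

variable [MeasurableSpace S] [MeasurableSingletonClass S]
  [MeasurableSpace A] [MeasurableSingletonClass A]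

/-- The law `ζ_π` of the trajectory `(S₀, A₀), (S₁, A₁), …` under the stationary policy `π`:
`S₀` has law `init`, `A_t` has law `π(·|S_t)` and `S_{t+1}` has law `trans S_t A_t`. -/
def trajLaw (M : GUMDP S A) (π : S → PMF A) : Measure (ℕ → S × A) :=
  markovLaw (withAction π M.init) fun x => withAction π (M.trans x.1 x.2)

/-- The law of `K` independent trajectories. -/
def trialsLaw (M : GUMDP S A) (π : S → PMF A) (K : ℕ) : Measure (Fin K → ℕ → S × A) :=
  Measure.pi fun _ => M.trajLaw π

/-- `(1 / H) ∑_{t < H} ℙ((S_t, A_t) = x)`. -/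
def expFreq (M : GUMDP S A) (π : S → PMF A) (x : S × A) (H : ℕ) : ℝ :=
  (1 / (H : ℝ)) * ∑ t ∈ Finset.range H, (M.trajLaw π).real {τ | τ t = x}

/-- The average state-action occupancy `d_π`. -/
def avgOcc (M : GUMDP S A) (π : S → PMF A) : EuclideanSpace ℝ (S × A) :=
  WithLp.toLp 2 fun x => limUnder atTop (M.expFreq π x)

/-- The infinite trials objective `f_∞(π) = f(d_π)`. -/
def infiniteTrials (M : GUMDP S A) (π : S → PMF A) : ℝ :=
  M.utility (M.avgOcc π)

/-- The finite trials objective `f_K(π)`, the expectation of `f` at the empirical average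
occupancy of `K` independent trajectories. -/
def finiteTrials (M : GUMDP S A) (π : S → PMF A) (K : ℕ) : ℝ :=
  ∫ T, M.utility (empOccTrials T) ∂(M.trialsLaw π K)

end GUMDP

/-- The first-order inequality for strong convexity, with an arbitrary vector in the role of the
gradient, implies `StrongConvexOn`, which needs no differentiability. -/
theorem strongConvexOn_of_firstOrder {E : Type*} [NormedAddCommGroup E] [InnerProductSpace ℝ E]
    {s : Set E} (hs : Convex ℝ s) {c : ℝ} {f : E → ℝ} (g : E → E)
    (h : ∀ x ∈ s, ∀ y ∈ s, f y + inner ℝ (g y) (x - y) + c / 2 * ‖x - y‖ ^ 2 ≤ f x) :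
    StrongConvexOn s c f := by
  refine ⟨hs, fun x hx y hy a b ha hb hab => ?_⟩
  have hz : a • x + b • y ∈ s := hs hx hy ha hb hab
  have h1 := h x hx _ hz
  have h2 := h y hy _ hz
  obtain rfl : a = 1 - b := by linarith
  have e1 : x - ((1 - b) • x + b • y) = b • (x - y) := by module
  have e2 : y - ((1 - b) • x + b • y) = (-(1 - b)) • (x - y) := by module
  rw [e1, inner_smul_right, norm_smul, mul_pow, Real.norm_eq_abs, sq_abs] at h1
  rw [e2, inner_smul_right, norm_smul, mul_pow, Real.norm_eq_abs, sq_abs] at h2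
  have h3 := mul_le_mul_of_nonneg_left h1 ha
  have h4 := mul_le_mul_of_nonneg_left h2 hb
  simp only [smul_eq_mul]
  linear_combination h3 + h4

end

/-!
Jensen's gap for a `c`-strongly convex function is at least `c / 2` times the total variance of its
argument, and averaging `K` independent occupancies divides that variance by `K`. It remains to
compute, for one trajectory, the variance of the occupancy of a pair `(s, a)` over a recurrent
class.

The state-action process is itself a Markov chain. A function `g` on its finite state space is a
harmonic function plus a coboundary `P v - v` (mean ergodic theorem). Along a trajectory the
averages of the coboundary vanish, by the strong law for bounded martingale differences, while the
harmonic part is a bounded martingale and converges. So the occupancy is the Cesàro row of any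
state visited infinitely often. Over a recurrent class `R` with stationary distribution `μ` that row
is `π(a|s) μ(s)`, hence the occupancy of `(s, a)` is `π(a|s) μ(s)` times the indicator of absorption
into `R`, a Bernoulli variable of parameter `α`, with variance `α (1 - α) π(a|s)² μ(s)²`.
-/

noncomputable section

section MeanErgodic

variable {𝕜 E : Type*} [RCLike 𝕜] [NormedAddCommGroup E] [NormedSpace 𝕜 E] {f : E →ₗ[𝕜] E}

lemma isBounded_range_iterate_of_lipschitzWith_one (hf : LipschitzWith 1 f) (x : E) :
    Bornology.IsBounded (Set.range fun n => f^[n] x) := by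
  have hzero : ∀ n, f^[n] 0 = 0 := fun n => iterate_map_zero f n
  refine isBounded_iff_forall_norm_le.2 ⟨‖x‖, Set.forall_mem_range.2 fun n => ?_⟩
  simpa [hzero] using (hf.iterate n).dist_le_mul x 0

lemma birkhoffAverage_id_add (f : E →ₗ[𝕜] E) (n : ℕ) (x y : E) :
    birkhoffAverage 𝕜 f id n (x + y) = birkhoffAverage 𝕜 f id n x + birkhoffAverage 𝕜 f id n y := by
  have hadd : ∀ k, f^[k] (x + y) = f^[k] x + f^[k] y := fun k => iterate_map_add f k x y
  simp [birkhoffAverage, birkhoffSum, hadd, Finset.sum_add_distrib]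

lemma tendsto_birkhoffAverage_coboundary (hf : LipschitzWith 1 f) (x : E) :
    Tendsto (birkhoffAverage 𝕜 f id · (f x - x)) atTop (𝓝 0) := by
  have hsub : ∀ n x y, f^[n] (x - y) = f^[n] x - f^[n] y := iterate_map_sub f
  simpa [birkhoffAverage, birkhoffSum, Finset.sum_sub_distrib, smul_sub, hsub] using
    tendsto_birkhoffAverage_apply_sub_birkhoffAverage (g := id) 𝕜
      (isBounded_range_iterate_of_lipschitzWith_one hf x)

lemma disjoint_ker_range_sub_one (hf : LipschitzWith 1 f) :
    Disjoint (f - 1).ker (f - 1).range := by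
  rw [Submodule.disjoint_def]
  rintro _ hfix ⟨x, rfl⟩
  have hfix : Function.IsFixedPt f ((f - 1) x) := sub_eq_zero.1 hfix
  exact tendsto_nhds_unique (hfix.tendsto_birkhoffAverage 𝕜 id)
    (tendsto_birkhoffAverage_coboundary hf x)

variable [FiniteDimensional 𝕜 E]

lemma isCompl_ker_range_sub_one (hf : LipschitzWith 1 f) :
    IsCompl (f - 1).ker (f - 1).range := by
  refine (Submodule.isCompl_iff_disjoint _ _ ?_).2 (disjoint_ker_range_sub_one hf)
  rw [add_comm, LinearMap.finrank_range_add_finrank_ker]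

/-- The ergodic projection of a linear contraction `f`: the projection onto the fixed points of `f`
along the coboundaries `f v - v`. -/
def fixedProj (hf : LipschitzWith 1 f) : E →ₗ[𝕜] E :=
  Submodule.projection _ _ (isCompl_ker_range_sub_one hf)

lemma map_fixedProj (hf : LipschitzWith 1 f) (x : E) : f (fixedProj hf x) = fixedProj hf x :=
  sub_eq_zero.1 (Submodule.projection_apply_mem (isCompl_ker_range_sub_one hf) x)

lemma exists_eq_fixedProj_add_coboundary (hf : LipschitzWith 1 f) (x : E) :
    ∃ v, x = fixedProj hf x + (f v - v) := by
  have hsum := Submodule.projection_add_projection_eq_self (isCompl_ker_range_sub_one hf) x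
  obtain ⟨v, hv⟩ := Submodule.projection_apply_mem (isCompl_ker_range_sub_one hf).symm x
  exact ⟨v, by rw [← hv] at hsum; exact hsum.symm⟩

lemma fixedProj_eq_self (hf : LipschitzWith 1 f) {x : E} (hx : f x = x) : fixedProj hf x = x :=
  Submodule.projection_apply_of_mem_left _ (sub_eq_zero.2 hx)

lemma fixedProj_map (hf : LipschitzWith 1 f) (x : E) : fixedProj hf (f x) = fixedProj hf x := by
  rw [← sub_eq_zero, ← map_sub, fixedProj, Submodule.projection_apply_eq_zero_iff]
  exact ⟨x, rfl⟩

lemma tendsto_birkhoffAverage_fixedProj (hf : LipschitzWith 1 f) (x : E) :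
    Tendsto (birkhoffAverage 𝕜 f id · x) atTop (𝓝 (fixedProj hf x)) := by
  obtain ⟨v, hv⟩ := exists_eq_fixedProj_add_coboundary hf x
  have hfix : Function.IsFixedPt f (fixedProj hf x) := map_fixedProj hf x
  have hlim := (hfix.tendsto_birkhoffAverage 𝕜 id).add (tendsto_birkhoffAverage_coboundary hf v)
  rw [id, add_zero] at hlim
  refine hlim.congr fun n => ?_
  rw [← birkhoffAverage_id_add, ← hv]

end MeanErgodic

section TransitionOperator

lemma IsStationaryOn.support_subset {X : Type*} {P : X → PMF X} {R : Finset X}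
    {μ : PMF X} (hμ : IsStationaryOn P R μ) : μ.support ⊆ R :=
  fun x hx => not_imp_comm.1 (hμ.2 x) hx

variable {X Y : Type*} [Fintype X] [Fintype Y]

lemma sum_pmf_toReal (p : PMF X) : ∑ x, (p x).toReal = 1 := by
  rw [← ENNReal.toReal_sum fun x _ => p.apply_ne_top x, ← tsum_fintype (L := .unconditional _),
    p.tsum_coe, ENNReal.toReal_one]

/-- The mean of a function under a probability distribution on a finite set, as a linear functional;
this is the integral against `p.toMeasure`, without a choice of measurable structure. -/
def pmfMean (p : PMF X) : (X → ℝ) →ₗ[ℝ] ℝ := ∑ x, (p x).toReal • LinearMap.proj x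

lemma pmfMean_apply (p : PMF X) (g : X → ℝ) : pmfMean p g = ∑ x, (p x).toReal * g x := by
  simp [pmfMean]

lemma pmfMean_const (p : PMF X) (b : ℝ) : pmfMean p (fun _ => b) = b := by
  rw [pmfMean_apply, ← Finset.sum_mul, sum_pmf_toReal, one_mul]

lemma pmfMean_mono {p : PMF X} {g g' : X → ℝ} (h : ∀ x ∈ p.support, g x ≤ g' x) :
    pmfMean p g ≤ pmfMean p g' := by
  rw [pmfMean_apply, pmfMean_apply]
  refine Finset.sum_le_sum fun x _ => ?_
  by_cases hx : p x = 0
  · simp [hx]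
  · exact mul_le_mul_of_nonneg_left (h x hx) ENNReal.toReal_nonneg

lemma pmfMean_congr {p : PMF X} {g g' : X → ℝ} (h : ∀ x ∈ p.support, g x = g' x) :
    pmfMean p g = pmfMean p g' :=
  le_antisymm (pmfMean_mono fun x hx => (h x hx).le) (pmfMean_mono fun x hx => (h x hx).ge)

lemma pmfMean_eq_of_forall_eq {p : PMF X} {g : X → ℝ} {b : ℝ} (h : ∀ x ∈ p.support, g x = b) :
    pmfMean p g = b :=
  (pmfMean_congr h).trans (pmfMean_const p b)

lemma abs_pmfMean_le (p : PMF X) (g : X → ℝ) : |pmfMean p g| ≤ ‖g‖ := by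
  have hg : ∀ x, |g x| ≤ ‖g‖ := norm_le_pi_norm g
  refine abs_le.2 ⟨?_, (pmfMean_mono fun x _ => (abs_le.1 (hg x)).2).trans_eq (pmfMean_const p _)⟩
  exact (pmfMean_const p _).symm.trans_le (pmfMean_mono fun x _ => (abs_le.1 (hg x)).1)

lemma eq_of_pmfMean_eq_of_le {p : PMF X} {g : X → ℝ} {b : ℝ} (hg : ∀ x ∈ p.support, g x ≤ b)
    (hb : pmfMean p g = b) : ∀ x ∈ p.support, g x = b := by
  intro x hx
  refine (hg x hx).antisymm (not_lt.1 fun hlt => ?_)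
  suffices pmfMean p g < pmfMean p fun _ => b by
    rw [pmfMean_const, hb] at this
    exact lt_irrefl b this
  rw [pmfMean_apply, pmfMean_apply]
  refine Finset.sum_lt_sum (fun y _ => ?_) ⟨x, Finset.mem_univ x, ?_⟩
  · by_cases hy : p y = 0
    · simp [hy]
    · exact mul_le_mul_of_nonneg_left (hg y hy) ENNReal.toReal_nonneg
  · exact mul_lt_mul_of_pos_left hlt (ENNReal.toReal_pos hx (p.apply_ne_top x))

lemma pmfMean_indicator_singleton (p : PMF X) (x : X) :
    pmfMean p (Set.indicator {x} fun _ => 1) = (p x).toReal := by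
  classical
  simp [pmfMean_apply, Pi.single_apply]

lemma pmf_ext_of_pmfMean {p q : PMF X} (h : ∀ g, pmfMean p g = pmfMean q g) : p = q := by
  ext x
  rw [← ENNReal.toReal_eq_toReal_iff' (p.apply_ne_top x) (q.apply_ne_top x),
    ← pmfMean_indicator_singleton, ← pmfMean_indicator_singleton, h]

lemma pmfMean_pure (x : X) (g : X → ℝ) : pmfMean (PMF.pure x) g = g x := by
  classical
  simp [pmfMean_apply, PMF.pure_apply, apply_ite ENNReal.toReal]

lemma pmfMean_bind (p : PMF X) (q : X → PMF Y) (g : Y → ℝ) :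
    pmfMean (p.bind q) g = pmfMean p fun x => pmfMean (q x) g := by
  have hbind : ∀ y, (p.bind q y).toReal = ∑ x, (p x).toReal * (q x y).toReal := fun y => by
    rw [PMF.bind_apply, tsum_fintype, ENNReal.toReal_sum fun x _ =>
      ENNReal.mul_ne_top (p.apply_ne_top x) ((q x).apply_ne_top y)]
    simp only [ENNReal.toReal_mul]
  simp only [pmfMean_apply, hbind, Finset.sum_mul, Finset.mul_sum, mul_assoc]
  exact Finset.sum_comm

lemma pmfMean_map (p : PMF X) (φ : X → Y) (g : Y → ℝ) :
    pmfMean (p.map φ) g = pmfMean p fun x => g (φ x) := by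
  rw [PMF.map, pmfMean_bind]
  simp only [Function.comp_apply, pmfMean_pure]

/-- The transition operator `g ↦ (x ↦ 𝔼[g(X₁) | X₀ = x])` of the chain with transition
probabilities `P`. The harmonic functions are its fixed points. -/
def transOp (P : X → PMF X) : (X → ℝ) →ₗ[ℝ] (X → ℝ) := LinearMap.pi fun x => pmfMean (P x)

lemma transOp_apply (P : X → PMF X) (g : X → ℝ) (x : X) : transOp P g x = pmfMean (P x) g := rfl

lemma lipschitzWith_transOp (P : X → PMF X) : LipschitzWith 1 (transOp P) :=
  AddMonoidHomClass.lipschitz_of_bound_nnnorm _ 1 fun g => by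
    rw [one_mul]
    exact (pi_norm_le_iff_of_nonneg (norm_nonneg g)).2 fun x => abs_pmfMean_le (P x) g

lemma abs_sub_transOp_le (P : X → PMF X) (v : X → ℝ) (x y : X) :
    |v y - transOp P v x| ≤ ‖v‖ + ‖v‖ :=
  (abs_sub _ _).trans (add_le_add (norm_le_pi_norm v y) (abs_pmfMean_le (P x) v))

lemma pmfMean_transOp_of_stationary {P : X → PMF X} {μ : PMF X} (hμ : μ.bind P = μ) (g : X → ℝ) :
    pmfMean μ (transOp P g) = pmfMean μ g := by
  conv_rhs => rw [← hμ, pmfMean_bind]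
  rfl

/-- The projection of a function onto the harmonic functions of the chain, the limit of its
expected averages along the chain as a function of the starting point. -/
def harmonicProj (P : X → PMF X) : (X → ℝ) →ₗ[ℝ] (X → ℝ) := fixedProj (lipschitzWith_transOp P)

lemma transOp_harmonicProj (P : X → PMF X) (g : X → ℝ) :
    transOp P (harmonicProj P g) = harmonicProj P g :=
  map_fixedProj (lipschitzWith_transOp P) g

lemma exists_eq_harmonicProj_add_coboundary (P : X → PMF X) (g : X → ℝ) :
    ∃ v, g = harmonicProj P g + (transOp P v - v) :=
  exists_eq_fixedProj_add_coboundary (lipschitzWith_transOp P) g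

lemma harmonicProj_const (P : X → PMF X) (b : ℝ) : harmonicProj P (fun _ => b) = fun _ => b :=
  fixedProj_eq_self _ (funext fun x => pmfMean_const (P x) b)

lemma harmonicProj_transOp (P : X → PMF X) (g : X → ℝ) :
    harmonicProj P (transOp P g) = harmonicProj P g :=
  fixedProj_map (lipschitzWith_transOp P) g

lemma pmfMean_harmonicProj_of_stationary {P : X → PMF X} {μ : PMF X} (hμ : μ.bind P = μ)
    (g : X → ℝ) : pmfMean μ (harmonicProj P g) = pmfMean μ g := by
  obtain ⟨v, hv⟩ := exists_eq_harmonicProj_add_coboundary P g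
  conv_rhs => rw [hv, map_add, map_sub, pmfMean_transOp_of_stationary hμ, sub_self, add_zero]

/-- A set of states is closed if no transition of positive probability leaves it. -/
def IsClosedUnder (P : X → PMF X) (C : Set X) : Prop :=
  ∀ x ∈ C, (P x).support ⊆ C

lemma harmonicProj_nonneg_of_isClosedUnder {P : X → PMF X} {C : Set X} (hC : IsClosedUnder P C)
    {g : X → ℝ} (hg : ∀ x ∈ C, 0 ≤ g x) {x : X} (hx : x ∈ C) : 0 ≤ harmonicProj P g x := by
  have hiter : ∀ n, ∀ x ∈ C, 0 ≤ (transOp P)^[n] g x := fun n => by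
    induction n with
    | zero => exact hg
    | succ n ih =>
      intro x hx
      rw [Function.iterate_succ_apply', transOp_apply, ← pmfMean_const (P x) 0]
      exact pmfMean_mono fun y hy => ih y (hC x hx hy)
  have hlim := tendsto_birkhoffAverage_fixedProj (lipschitzWith_transOp P) g
  refine ge_of_tendsto' (tendsto_pi_nhds.1 hlim x) fun n => ?_
  simp only [birkhoffAverage, birkhoffSum, Pi.smul_apply, Finset.sum_apply, id, smul_eq_mul]
  exact mul_nonneg (by positivity) (Finset.sum_nonneg fun k _ => hiter k x hx)

lemma harmonicProj_eq_zero_of_isClosedUnder {P : X → PMF X} {C : Set X} (hC : IsClosedUnder P C)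
    {g : X → ℝ} (hg : ∀ x ∈ C, g x = 0) {x : X} (hx : x ∈ C) : harmonicProj P g x = 0 := by
  refine le_antisymm ?_ (harmonicProj_nonneg_of_isClosedUnder hC (fun y hy => (hg y hy).ge) hx)
  have hneg := harmonicProj_nonneg_of_isClosedUnder hC (g := -g) (fun y hy => by simp [hg y hy]) hx
  rwa [map_neg, Pi.neg_apply, neg_nonneg] at hneg

lemma harmonicProj_nonneg (P : X → PMF X) {g : X → ℝ} (hg : ∀ x, 0 ≤ g x) (x : X) :
    0 ≤ harmonicProj P g x :=
  harmonicProj_nonneg_of_isClosedUnder (C := Set.univ) (fun _ _ => Set.subset_univ _)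
    (fun y _ => hg y) (Set.mem_univ x)

lemma harmonicProj_apply_eq_sum (P : X → PMF X) (g : X → ℝ) (x : X) :
    harmonicProj P g x = ∑ y, harmonicProj P (Set.indicator {y} fun _ => 1) x * g y := by
  classical
  have hg : g = ∑ y, g y • Set.indicator {y} fun _ => (1 : ℝ) := by
    ext z
    simp [Finset.sum_apply, Pi.single_apply]
  conv_lhs => rw [hg]
  simp only [map_sum, map_smul, Finset.sum_apply, Pi.smul_apply, smul_eq_mul, mul_comm]

/-- The limiting occupation distribution of the chain started at `x`: the Cesàro limit of the laws
of its successive states. -/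
def cesaroPMF (P : X → PMF X) (x : X) : PMF X :=
  PMF.ofFintype (fun y => ENNReal.ofReal (harmonicProj P (Set.indicator {y} fun _ => 1) x)) (by
    have hone := harmonicProj_apply_eq_sum P (fun _ => 1) x
    simp only [harmonicProj_const, mul_one] at hone
    rw [← ENNReal.ofReal_sum_of_nonneg fun y _ =>
      harmonicProj_nonneg P (fun z => Set.indicator_nonneg (fun _ _ => zero_le_one) z) x,
      ← hone, ENNReal.ofReal_one])

lemma toReal_cesaroPMF_apply (P : X → PMF X) (x y : X) :
    (cesaroPMF P x y).toReal = harmonicProj P (Set.indicator {y} fun _ => 1) x := by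
  rw [cesaroPMF, PMF.ofFintype_apply, ENNReal.toReal_ofReal]
  exact harmonicProj_nonneg P (fun z => Set.indicator_nonneg (fun _ _ => zero_le_one) z) x

lemma pmfMean_cesaroPMF (P : X → PMF X) (x : X) (g : X → ℝ) :
    pmfMean (cesaroPMF P x) g = harmonicProj P g x := by
  simp only [pmfMean_apply, toReal_cesaroPMF_apply, ← harmonicProj_apply_eq_sum]

lemma cesaroPMF_bind (P : X → PMF X) (x : X) : (cesaroPMF P x).bind P = cesaroPMF P x := by
  refine pmf_ext_of_pmfMean fun g => ?_
  rw [pmfMean_bind, pmfMean_cesaroPMF, pmfMean_cesaroPMF]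
  exact congrFun (harmonicProj_transOp P g) x

lemma support_cesaroPMF_subset {P : X → PMF X} {C : Set X} (hC : IsClosedUnder P C) {x : X}
    (hx : x ∈ C) : (cesaroPMF P x).support ⊆ C := by
  refine fun y hy => by_contra fun hyC => hy ?_
  refine ((ENNReal.toReal_eq_zero_iff _).1 ?_).resolve_right ((cesaroPMF P x).apply_ne_top y)
  rw [toReal_cesaroPMF_apply]
  refine harmonicProj_eq_zero_of_isClosedUnder hC (fun z hz => ?_) hx
  exact Set.indicator_of_notMem (s := {y}) (fun hzy => hyC (hzy ▸ hz)) _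

/-- A closed set of states that communicate with each other. -/
structure IsClosedIrreducible (P : X → PMF X) (C : Set X) : Prop where
  isClosedUnder : IsClosedUnder P C
  reaches : ∀ x ∈ C, ∀ y ∈ C, Reaches P x y

namespace IsClosedIrreducible

variable {P : X → PMF X} {C : Set X}

-- Maximum principle: a harmonic function keeps its maximal value along every transition.
lemma eq_of_harmonic (hC : IsClosedIrreducible P C) {h : X → ℝ}
    (hh : ∀ x ∈ C, transOp P h x = h x) {x y : X} (hx : x ∈ C) (hy : y ∈ C) : h x = h y := by
  obtain ⟨z, hz, hmax⟩ := Set.exists_max_image C h C.toFinite ⟨x, hx⟩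
  have hreach : ∀ w, Reaches P z w → w ∈ C ∧ h w = h z := fun w hw => by
    induction hw with
    | refl => exact ⟨hz, rfl⟩
    | @tail u w _ huw ih =>
      obtain ⟨hu, hhu⟩ := ih
      have hsupp := hC.isClosedUnder u hu
      exact ⟨hsupp huw, eq_of_pmfMean_eq_of_le (fun v hv => hmax v (hsupp hv))
        ((hh u hu).trans hhu) w huw⟩
  rw [(hreach x (hC.reaches z hz x hx)).2, (hreach y (hC.reaches z hz y hy)).2]

lemma cesaroPMF_eq (hC : IsClosedIrreducible P C) {μ : PMF X} (hμ : μ.bind P = μ)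
    (hμC : μ.support ⊆ C) {x : X} (hx : x ∈ C) : cesaroPMF P x = μ := by
  refine pmf_ext_of_pmfMean fun g => ?_
  rw [pmfMean_cesaroPMF, ← pmfMean_harmonicProj_of_stationary hμ]
  exact (pmfMean_eq_of_forall_eq fun y hy =>
    hC.eq_of_harmonic (fun z _ => congrFun (transOp_harmonicProj P g) z) (hμC hy) hx).symm

lemma existsUnique_isStationaryOn {R : Finset X} (hR : IsClosedIrreducible P (R : Set X))
    (hne : R.Nonempty) : ∃! μ : PMF X, IsStationaryOn P R μ := by
  obtain ⟨x, hx⟩ := hne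
  have hsupp := support_cesaroPMF_subset hR.isClosedUnder hx
  refine ⟨cesaroPMF P x, ⟨cesaroPMF_bind P x, fun y hy => not_not.1 fun h => hy (hsupp h)⟩, ?_⟩
  exact fun μ hμ => (hR.cesaroPMF_eq hμ.1 hμ.support_subset hx).symm

end IsClosedIrreducible

end TransitionOperator

section MartingaleDifferences

/-- A sequence of square integrable increments of a martingale: `D k` is revealed at time `k + 1`
and has mean zero given the past up to time `k`. -/
structure IsMartingaleDiff {Ω : Type*} {m0 : MeasurableSpace Ω} (D : ℕ → Ω → ℝ)
    (ℱ : Filtration ℕ m0) (μ : Measure Ω) : Prop where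
  stronglyMeasurable : ∀ k, StronglyMeasurable[ℱ (k + 1)] (D k)
  memLp : ∀ k, MemLp (D k) 2 μ
  condExp_eq_zero : ∀ k, μ[D k | ℱ k] =ᵐ[μ] 0

lemma tendsto_average_zero_of_tendsto_sum_div {a : ℕ → ℝ} {l : ℝ}
    (h : Tendsto (fun n => ∑ k ∈ Finset.range n, ((k : ℝ) + 1)⁻¹ * a k) atTop (𝓝 l)) :
    Tendsto (fun n : ℕ => (n : ℝ)⁻¹ * ∑ k ∈ Finset.range n, a k) atTop (𝓝 0) := by
  set s : ℕ → ℝ := fun n => ∑ k ∈ Finset.range n, ((k : ℝ) + 1)⁻¹ * a k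
  have hparts : ∀ n : ℕ, ∑ k ∈ Finset.range n, a k = n * s n - ∑ k ∈ Finset.range n, s k :=
    fun n => by
      induction n with
      | zero => simp
      | succ n ih =>
        have hn : (n : ℝ) + 1 ≠ 0 := by positivity
        rw [Finset.sum_range_succ, ih, Finset.sum_range_succ,
          show s (n + 1) = s n + ((n : ℝ) + 1)⁻¹ * a n from Finset.sum_range_succ _ _]
        push_cast
        field_simp
        ring
  have hlim := h.sub h.cesaro
  rw [sub_self] at hlim
  refine hlim.congr' ?_
  filter_upwards [eventually_gt_atTop 0] with n hn
  have hn : (n : ℝ) ≠ 0 := by positivity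
  rw [hparts, mul_sub, inv_mul_cancel_left₀ hn]

namespace IsMartingaleDiff

variable {Ω : Type*} {m0 : MeasurableSpace Ω} {μ : Measure Ω} {ℱ : Filtration ℕ m0}
  {D : ℕ → Ω → ℝ}

lemma const_mul (hD : IsMartingaleDiff D ℱ μ) (w : ℕ → ℝ) :
    IsMartingaleDiff (fun k ω => w k * D k ω) ℱ μ where
  stronglyMeasurable k := (hD.stronglyMeasurable k).const_mul (w k)
  memLp k := (hD.memLp k).const_mul (w k)
  condExp_eq_zero k := by
    filter_upwards [condExp_smul (μ := μ) (w k) (D k) (ℱ k), hD.condExp_eq_zero k] with ω hω hD0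
    refine hω.trans ?_
    rw [Pi.smul_apply, hD0, Pi.zero_apply, smul_zero]

lemma stronglyMeasurable_sum (hD : IsMartingaleDiff D ℱ μ) (n : ℕ) :
    StronglyMeasurable[ℱ n] fun ω => ∑ k ∈ Finset.range n, D k ω :=
  Finset.stronglyMeasurable_fun_sum _ fun k hk =>
    (hD.stronglyMeasurable k).mono (ℱ.mono (Finset.mem_range.1 hk))

lemma memLp_sum (hD : IsMartingaleDiff D ℱ μ) (n : ℕ) :
    MemLp (fun ω => ∑ k ∈ Finset.range n, D k ω) 2 μ :=
  memLp_finsetSum _ fun k _ => hD.memLp k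

variable [IsFiniteMeasure μ]

lemma integral_mul_eq_zero (hD : IsMartingaleDiff D ℱ μ) {n : ℕ} {g : Ω → ℝ}
    (hg : StronglyMeasurable[ℱ n] g) (hg2 : MemLp g 2 μ) : ∫ ω, g ω * D n ω ∂μ = 0 := by
  have hpull := condExp_mul_of_stronglyMeasurable_left hg (hg2.integrable_mul (hD.memLp n))
    ((hD.memLp n).integrable one_le_two)
  rw [← integral_condExp (ℱ.le n)]
  refine integral_eq_zero_of_ae ?_
  filter_upwards [hpull, hD.condExp_eq_zero n] with ω hω hD0
  refine hω.trans ?_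
  rw [Pi.mul_apply, hD0, Pi.zero_apply, mul_zero]

lemma martingale_sum (hD : IsMartingaleDiff D ℱ μ) :
    Martingale (fun n ω => ∑ k ∈ Finset.range n, D k ω) ℱ μ := by
  refine martingale_of_condExp_sub_eq_zero_nat hD.stronglyMeasurable_sum
    (fun n => (hD.memLp_sum n).integrable one_le_two) fun n => ?_
  refine EventuallyEq.trans (Eventually.of_forall fun ω => ?_) (hD.condExp_eq_zero n)
  congr
  ext ω
  simp [Finset.sum_range_succ]

lemma integral_sum_sq (hD : IsMartingaleDiff D ℱ μ) (n : ℕ) :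
    ∫ ω, (∑ k ∈ Finset.range n, D k ω) ^ 2 ∂μ = ∑ k ∈ Finset.range n, ∫ ω, D k ω ^ 2 ∂μ := by
  induction n with
  | zero => simp
  | succ n ih =>
    have hsum := hD.memLp_sum n
    have hcross := hD.integral_mul_eq_zero (hD.stronglyMeasurable_sum n) hsum
    have hint : Integrable (fun ω => (∑ k ∈ Finset.range n, D k ω) * D n ω) μ :=
      hsum.integrable_mul (hD.memLp n)
    have hint2 : Integrable (fun ω => (∑ k ∈ Finset.range n, D k ω) ^ 2 +
        2 * ((∑ k ∈ Finset.range n, D k ω) * D n ω)) μ :=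
      hsum.integrable_sq.add (hint.const_mul 2)
    simp only [Finset.sum_range_succ, add_sq, mul_assoc]
    rw [integral_add hint2 (hD.memLp n).integrable_sq,
      integral_add hsum.integrable_sq (hint.const_mul 2), integral_const_mul, hcross, ih,
      mul_zero, add_zero]

lemma ae_exists_tendsto_sum (hD : IsMartingaleDiff D ℱ μ) {b : ℝ}
    (hb : ∀ n, ∫ ω, (∑ k ∈ Finset.range n, D k ω) ^ 2 ∂μ ≤ b) :
    ∀ᵐ ω ∂μ, ∃ l, Tendsto (fun n => ∑ k ∈ Finset.range n, D k ω) atTop (𝓝 l) := by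
  refine hD.martingale_sum.submartingale.exists_ae_tendsto_of_bdd
    (R := (μ.real Set.univ + b).toNNReal) fun n => ?_
  have hsum := hD.memLp_sum n
  have hint := hsum.integrable one_le_two
  rw [eLpNorm_one_eq_lintegral_enorm, ← ofReal_integral_norm_eq_lintegral_enorm hint]
  refine ENNReal.ofReal_le_ofReal ?_
  calc ∫ ω, ‖∑ k ∈ Finset.range n, D k ω‖ ∂μ
      ≤ ∫ ω, (1 + (∑ k ∈ Finset.range n, D k ω) ^ 2) ∂μ := by
        refine integral_mono hint.norm ((integrable_const _).add hsum.integrable_sq) fun ω => ?_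
        rw [Real.norm_eq_abs, ← sq_abs]
        nlinarith [sq_nonneg (|∑ k ∈ Finset.range n, D k ω| - 1)]
    _ ≤ μ.real Set.univ + b := by
        rw [integral_add (integrable_const _) hsum.integrable_sq, integral_const, smul_eq_mul,
          mul_one]
        exact add_le_add_right (hb n) _

lemma ae_tendsto_average_zero (hD : IsMartingaleDiff D ℱ μ)
    (hsum : Summable fun k : ℕ => ((k : ℝ) + 1)⁻¹ ^ 2 * ∫ ω, D k ω ^ 2 ∂μ) :
    ∀ᵐ ω ∂μ, Tendsto (fun n : ℕ => (n : ℝ)⁻¹ * ∑ k ∈ Finset.range n, D k ω) atTop (𝓝 0) := by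
  have hE := hD.const_mul fun k => ((k : ℝ) + 1)⁻¹
  have hconv := hE.ae_exists_tendsto_sum (b := ∑' k : ℕ, ((k : ℝ) + 1)⁻¹ ^ 2 * ∫ ω, D k ω ^ 2 ∂μ)
    fun n => by
      rw [hE.integral_sum_sq]
      simp only [mul_pow, integral_const_mul]
      exact hsum.sum_le_tsum _ fun k _ => by positivity
  filter_upwards [hconv] with ω ⟨l, hl⟩
  exact tendsto_average_zero_of_tendsto_sum_div hl

lemma ae_tendsto_average_zero_of_abs_le (hD : IsMartingaleDiff D ℱ μ) {b : ℝ}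
    (hb : ∀ k ω, |D k ω| ≤ b) :
    ∀ᵐ ω ∂μ, Tendsto (fun n : ℕ => (n : ℝ)⁻¹ * ∑ k ∈ Finset.range n, D k ω) atTop (𝓝 0) := by
  refine hD.ae_tendsto_average_zero (Summable.of_nonneg_of_le (fun k => by positivity)
    (f := fun k : ℕ => ((k : ℝ) + 1)⁻¹ ^ 2 * (μ.real Set.univ * b ^ 2)) (fun k => ?_) ?_)
  · refine mul_le_mul_of_nonneg_left ?_ (by positivity)
    refine (integral_mono (hD.memLp k).integrable_sq (integrable_const (b ^ 2))
      fun ω => sq_le_sq' (abs_le.1 (hb k ω)).1 (abs_le.1 (hb k ω)).2).trans_eq ?_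
    rw [integral_const, smul_eq_mul]
  · refine Summable.mul_right _ ?_
    have hsq := (summable_nat_add_iff 1).2 (Real.summable_nat_pow_inv.2 one_lt_two)
    simpa only [inv_pow, Nat.cast_add, Nat.cast_one] using hsq

end IsMartingaleDiff

end MartingaleDifferences

section PathMeasure

variable {X : Type*} [Fintype X] [MeasurableSpace X] [MeasurableSingletonClass X]

instance instIsProbabilityMeasureMarkovLaw (ν : PMF X) (P : X → PMF X) :
    IsProbabilityMeasure (markovLaw ν P) := by
  unfold markovLaw
  infer_instance

lemma integral_toMeasure_eq_pmfMean (p : PMF X) (g : X → ℝ) :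
    ∫ x, g x ∂p.toMeasure = pmfMean p g := by
  simp [PMF.integral_eq_sum, pmfMean_apply]

lemma integrable_comp_of_finite {Ω Y : Type*} [MeasurableSpace Ω] {μ : Measure Ω}
    [IsFiniteMeasure μ] [Finite Y] [MeasurableSpace Y] [MeasurableSingletonClass Y] {Z : Ω → Y}
    (hZ : Measurable Z) (g : Y → ℝ) : Integrable (fun ω => g (Z ω)) μ :=
  Integrable.of_finite.comp_measurable hZ

lemma condExp_markovLaw_succ (ν : PMF X) (P : X → PMF X) (φ : X → X → ℝ) (n : ℕ) :
    (markovLaw ν P)[fun ω => φ (ω n) (ω (n + 1)) | Filtration.piLE (X := fun _ : ℕ => X) n]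
      =ᵐ[markovLaw ν P] fun ω => pmfMean (P (ω n)) (φ (ω n)) := by
  have : Nonempty X := ν.support_nonempty.to_type
  set F : (Finset.Iic n → X) × X → ℝ := fun z => φ (z.1 ⟨n, Finset.mem_Iic.2 le_rfl⟩) z.2
  have hcond := condExp_prod_ae_eq_integral_condDistrib (μ := markovLaw ν P)
    (X := Preorder.frestrictLe (π := fun _ => X) n) (Y := fun ω : ℕ → X => ω (n + 1)) (f := F)
    (by fun_prop) (measurable_pi_apply (n + 1)).aemeasurable
    (measurable_of_finite F).stronglyMeasurable (integrable_comp_of_finite (by fun_prop) F)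
  have hdistrib := Kernel.condDistrib_trajMeasure (X := fun _ => X) (μ₀ := ν.toMeasure)
    (κ := markovStep P) (a := n)
  rw [Filtration.piLE_eq_comap_frestrictLe]
  filter_upwards [hcond, ae_of_ae_map (by fun_prop) hdistrib] with ω hω hstep
  refine hω.trans ?_
  change ∫ y, _ ∂(condDistrib _ _ (Kernel.trajMeasure _ _) _) = _
  rw [hstep]
  exact integral_toMeasure_eq_pmfMean _ _

lemma integral_markovLaw_transition (ν : PMF X) (P : X → PMF X) (φ : X → X → ℝ) (n : ℕ) :
    ∫ ω, φ (ω n) (ω (n + 1)) ∂(markovLaw ν P) =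
      ∫ ω, pmfMean (P (ω n)) (φ (ω n)) ∂(markovLaw ν P) := by
  rw [← integral_condExp (Filtration.piLE.le n)]
  exact integral_congr_ae (condExp_markovLaw_succ ν P φ n)

lemma integral_markovLaw_zero (ν : PMF X) (P : X → PMF X) (g : X → ℝ) :
    ∫ ω, g (ω 0) ∂(markovLaw ν P) = pmfMean ν g := by
  have hlaw : (markovLaw ν P).map (fun ω => ω 0) = ν.toMeasure := by
    have hpath : (markovLaw ν P).map (Preorder.frestrictLe 0) =
        ν.toMeasure.map (MeasurableEquiv.piUnique fun _ : Finset.Iic 0 => X).symm := by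
      rw [markovLaw, Kernel.trajMeasure, Measure.map_comp _ _ (by fun_prop),
        Kernel.traj_map_frestrictLe, Kernel.partialTraj_self, Measure.id_comp]
    have hmap := congrArg (Measure.map (MeasurableEquiv.piUnique fun _ : Finset.Iic 0 => X)) hpath
    rwa [MeasurableEquiv.map_map_symm, Measure.map_map (by fun_prop) (by fun_prop)] at hmap
  rw [← integral_toMeasure_eq_pmfMean, ← hlaw,
    integral_map (measurable_pi_apply 0).aemeasurable (measurable_of_finite g).aestronglyMeasurable]

lemma integral_markovLaw_eq_iterate (ν : PMF X) (P : X → PMF X) (g : X → ℝ) (n : ℕ) :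
    ∫ ω, g (ω n) ∂(markovLaw ν P) = pmfMean ν ((transOp P)^[n] g) := by
  induction n generalizing g with
  | zero => exact integral_markovLaw_zero ν P g
  | succ n ih => exact (integral_markovLaw_transition ν P (fun _ => g) n).trans (ih (transOp P g))

lemma ae_mem_support_transition (ν : PMF X) (P : X → PMF X) :
    ∀ᵐ ω ∂(markovLaw ν P), ∀ n, ω (n + 1) ∈ (P (ω n)).support := by
  classical
  refine ae_all_iff.2 fun n => ?_
  set φ : X → X → ℝ := fun x => Set.indicator (P x).supportᶜ fun _ => 1
  have hφ : ∀ x y, 0 ≤ φ x y := fun x => Set.indicator_nonneg fun _ _ => zero_le_one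
  have hmean := integral_markovLaw_transition ν P φ n
  have hzero : ∀ x, pmfMean (P x) (φ x) = 0 := fun x =>
    pmfMean_eq_of_forall_eq fun y hy => Set.indicator_of_notMem (not_not.2 hy) _
  simp only [hzero, integral_zero] at hmean
  rw [integral_eq_zero_iff_of_nonneg (fun ω => hφ _ _) (integrable_comp_of_finite
    (Z := fun ω : ℕ → X => (ω n, ω (n + 1))) (by fun_prop) fun z => φ z.1 z.2)] at hmean
  filter_upwards [hmean] with ω hω
  by_contra hsupp
  simp [φ, hsupp] at hω

lemma ae_mem_of_isClosedUnder (ν : PMF X) {P : X → PMF X} {C : Set X} (hC : IsClosedUnder P C) :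
    ∀ᵐ ω ∂(markovLaw ν P), ∀ n, ω n ∈ C → ∀ m, n ≤ m → ω m ∈ C := by
  filter_upwards [ae_mem_support_transition ν P] with ω hω n hn m hm
  induction m, hm using Nat.le_induction with
  | base => exact hn
  | succ m _ ih => exact hC _ ih (hω m)

lemma isMartingaleDiff_sub_transOp (ν : PMF X) (P : X → PMF X) (v : X → ℝ) :
    IsMartingaleDiff (fun k ω => v (ω (k + 1)) - transOp P v (ω k))
      (Filtration.piLE (X := fun _ : ℕ => X)) (markovLaw ν P) where
  stronglyMeasurable k := by
    rw [Filtration.piLE_eq_comap_frestrictLe]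
    have hF := (measurable_of_finite fun h : Finset.Iic (k + 1) → X =>
      v (h ⟨k + 1, Finset.mem_Iic.2 le_rfl⟩) -
        transOp P v (h ⟨k, Finset.mem_Iic.2 k.le_succ⟩)).comp
      (comap_measurable (Preorder.frestrictLe (π := fun _ : ℕ => X) (k + 1)))
    exact hF.stronglyMeasurable
  memLp k := by
    have hZ : Measurable fun ω : ℕ → X => (ω (k + 1), ω k) := by fun_prop
    exact MemLp.of_bound ((measurable_of_finite fun z : X × X => v z.1 - transOp P v z.2).comp
      hZ).aestronglyMeasurable _ (Eventually.of_forall fun ω => abs_sub_transOp_le P v _ _)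
  condExp_eq_zero k := by
    refine (condExp_markovLaw_succ ν P (fun x y => v y - transOp P v x) k).trans
      (Eventually.of_forall fun ω => ?_)
    have hsub : (fun y => v y - transOp P v (ω k)) = v - fun _ => transOp P v (ω k) := rfl
    simp only [hsub, map_sub, pmfMean_const]
    exact sub_self _

lemma ae_exists_tendsto_of_harmonic (ν : PMF X) {P : X → PMF X} {h : X → ℝ}
    (hh : transOp P h = h) :
    ∀ᵐ ω ∂(markovLaw ν P), ∃ l, Tendsto (fun n => h (ω n)) atTop (𝓝 l) := by
  have hdiff := isMartingaleDiff_sub_transOp ν P h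
  rw [hh] at hdiff
  have htel : ∀ n (ω : ℕ → X), ∑ k ∈ Finset.range n, (h (ω (k + 1)) - h (ω k)) =
      h (ω n) - h (ω 0) := fun n ω => Finset.sum_range_sub (fun k => h (ω k)) n
  have hconv := hdiff.ae_exists_tendsto_sum (b := (‖h‖ + ‖h‖) ^ 2) fun n => by
    refine (integral_mono (hdiff.memLp_sum n).integrable_sq
      (integrable_const ((‖h‖ + ‖h‖) ^ 2)) fun ω => ?_).trans_eq (by simp)
    simp only [htel]
    exact sq_le_sq.2 ((abs_sub _ _).trans
      ((add_le_add (norm_le_pi_norm h _) (norm_le_pi_norm h _)).trans (le_abs_self _)))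
  filter_upwards [hconv] with ω ⟨l, hl⟩
  refine ⟨l + h (ω 0), (hl.add_const (h (ω 0))).congr fun n => ?_⟩
  rw [htel, sub_add_cancel]

lemma ae_tendsto_average_coboundary (ν : PMF X) (P : X → PMF X) (v : X → ℝ) :
    ∀ᵐ ω ∂(markovLaw ν P), Tendsto
      (fun n : ℕ => (n : ℝ)⁻¹ * ∑ k ∈ Finset.range n, (transOp P v - v) (ω k)) atTop (𝓝 0) := by
  filter_upwards [(isMartingaleDiff_sub_transOp ν P v).ae_tendsto_average_zero_of_abs_le
    fun k ω => abs_sub_transOp_le P v _ _] with ω hω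
  have htel : Tendsto (fun n : ℕ => (n : ℝ)⁻¹ * (v (ω n) - v (ω 0))) atTop (𝓝 0) := by
    refine (tendsto_inv_atTop_nhds_zero_nat (𝕜 := ℝ)).zero_mul_isBoundedUnder_le ?_
    exact isBoundedUnder_of ⟨‖v‖ + ‖v‖, fun n =>
      (abs_sub _ _).trans (add_le_add (norm_le_pi_norm v _) (norm_le_pi_norm v _))⟩
  have hsub := htel.sub hω
  rw [sub_zero] at hsub
  refine hsub.congr fun n => ?_
  rw [← mul_sub, ← Finset.sum_range_sub (fun k => v (ω k)) n, ← Finset.sum_sub_distrib]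
  simp only [Pi.sub_apply, sub_sub_sub_cancel_left]

theorem ae_exists_tendsto_average (ν : PMF X) (P : X → PMF X) (g : X → ℝ) :
    ∀ᵐ ω ∂(markovLaw ν P), ∃ l,
      Tendsto (fun n => harmonicProj P g (ω n)) atTop (𝓝 l) ∧
      Tendsto (fun n : ℕ => (n : ℝ)⁻¹ * ∑ k ∈ Finset.range n, g (ω k)) atTop (𝓝 l) := by
  obtain ⟨v, hv⟩ := exists_eq_harmonicProj_add_coboundary P g
  filter_upwards [ae_exists_tendsto_of_harmonic ν (transOp_harmonicProj P g),
    ae_tendsto_average_coboundary ν P v] with ω ⟨l, hl⟩ hcob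
  refine ⟨l, hl, ?_⟩
  have hsum := hl.cesaro.add hcob
  rw [add_zero] at hsum
  refine hsum.congr fun n => ?_
  rw [← mul_add, ← Finset.sum_add_distrib]
  conv_rhs => rw [hv]
  rfl

end PathMeasure

section RecurrentClass

variable {X : Type*} [Fintype X] [MeasurableSpace X] [MeasurableSingletonClass X] {P : X → PMF X}

lemma IsRecurrentState.reaches_of_mem_support {x y : X} (hx : IsRecurrentState P x)
    (hxy : y ∈ (P x).support) : Reaches P y x := by
  by_contra hyx
  have hclosed : IsClosedUnder P {z | Reaches P y z} := fun _ hu _ hw => hu.tail hw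
  have hmeas : MeasurableSet {ω : ℕ → X | ∃ t : ℕ, 1 ≤ t ∧ ω t = x} := by
    measurability
  have hreturn := (mem_ae_iff_prob_eq_one hmeas).2 hx
  have hone : (fun ω : ℕ → X => Set.indicator {y} (fun _ => (1 : ℝ)) (ω 1))
      =ᵐ[markovLaw (PMF.pure x) P] 0 := by
    filter_upwards [hreturn, ae_mem_of_isClosedUnder (PMF.pure x) hclosed] with ω ⟨t, ht, htx⟩ hω
    refine Set.indicator_of_notMem (s := {y}) (fun hy : ω 1 = y => hyx ?_) _
    exact htx ▸ hω 1 (hy ▸ Relation.ReflTransGen.refl) t ht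
  have hmean := integral_markovLaw_eq_iterate (PMF.pure x) P (Set.indicator {y} fun _ => 1) 1
  rw [integral_eq_zero_of_ae hone, Function.iterate_one, pmfMean_pure, transOp_apply,
    pmfMean_indicator_singleton] at hmean
  exact (ENNReal.toReal_pos hxy ((P x).apply_ne_top y)).ne hmean

namespace IsRecurrentClass

variable {R R' : Finset X}

lemma nonempty (hR : IsRecurrentClass P R) : R.Nonempty := by
  obtain ⟨⟨x, hx⟩, _⟩ := hR
  exact ⟨x, (hx x).2 ⟨.refl, .refl⟩⟩

lemma mem_iff (hR : IsRecurrentClass P R) {x : X} (hx : x ∈ R) (y : X) :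
    y ∈ R ↔ Reaches P x y ∧ Reaches P y x := by
  obtain ⟨⟨z, hz⟩, _⟩ := hR
  have hzx := (hz x).1 hx
  rw [hz y]
  exact ⟨fun hy => ⟨hzx.2.trans hy.1, hy.2.trans hzx.1⟩,
    fun hy => ⟨hzx.1.trans hy.1, hy.2.trans hzx.2⟩⟩

lemma eq_of_mem (hR : IsRecurrentClass P R) (hR' : IsRecurrentClass P R') {x : X} (hx : x ∈ R)
    (hx' : x ∈ R') : R = R' := by
  ext y
  rw [hR.mem_iff hx, hR'.mem_iff hx']

lemma isClosedIrreducible (hR : IsRecurrentClass P R) :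
    IsClosedIrreducible P (R : Set X) where
  isClosedUnder x hx y hxy :=
    (hR.mem_iff hx y).2 ⟨.single hxy, (hR.2 x hx).reaches_of_mem_support hxy⟩
  reaches _ hx y hy := ((hR.mem_iff hx y).1 hy).1

end IsRecurrentClass

lemma isRecurrentClass_of_mem_recurrentClasses {R : Finset X} (hR : R ∈ recurrentClasses P) :
    IsRecurrentClass P R := by
  classical
  exact (Finset.mem_filter.1 hR).2

end RecurrentClass

section EmpiricalOccupancy

variable {X : Type*}

lemma empFreq_nonneg (τ : ℕ → X) (x : X) (H : ℕ) : 0 ≤ empFreq τ x H :=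
  mul_nonneg (by positivity)
    (Finset.sum_nonneg fun _ _ => Set.indicator_nonneg (fun _ _ => zero_le_one) _)

lemma empFreq_le_one (τ : ℕ → X) (x : X) (H : ℕ) : empFreq τ x H ≤ 1 := by
  have hsum : ∑ t ∈ Finset.range H, Set.indicator {x} (fun _ => (1 : ℝ)) (τ t) ≤ H := by
    refine (Finset.sum_le_card_nsmul _ _ 1 fun t _ => ?_).trans (by simp)
    exact Set.indicator_le_self' (fun _ _ => zero_le_one) _
  rw [empFreq, one_div_mul_eq_div]
  exact div_le_one_of_le₀ hsum (Nat.cast_nonneg H)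

lemma empOcc_eq_zero {τ : ℕ → X} {x : X} (h : ∀ t, τ t ≠ x) : empOcc τ x = 0 := by
  have hfreq : empFreq τ x = fun _ => 0 := funext fun H => by
    have hzero : ∀ t, Set.indicator {x} (fun _ => (1 : ℝ)) (τ t) = 0 := fun t =>
      Set.indicator_of_notMem (s := {x}) (h t) _
    simp only [empFreq, hzero, Finset.sum_const_zero, mul_zero]
  rw [empOcc, hfreq]
  exact tendsto_const_nhds.limUnder_eq

variable [MeasurableSpace X]

lemma measurable_empFreq [MeasurableSingletonClass X] (x : X) (H : ℕ) :
    Measurable fun τ : ℕ → X => empFreq τ x H :=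
  (Finset.measurable_sum _ fun t _ => (measurable_const.indicator
    (measurableSet_singleton x)).comp (measurable_pi_apply t)).const_mul _

lemma measurableSet_exists_mem {C : Set X} (hC : MeasurableSet C) :
    MeasurableSet {τ : ℕ → X | ∃ t, τ t ∈ C} := by
  rw [Set.ofPred_exists]
  exact MeasurableSet.iUnion fun t => measurable_pi_apply t hC

variable [Fintype X] [MeasurableSingletonClass X]

-- A path visits some state `y` infinitely often, so every convergent function of the successive
-- states converges to its value at `y`.
lemma ae_exists_tendsto_empFreq (ν : PMF X) (P : X → PMF X) :
    ∀ᵐ τ ∂(markovLaw ν P), ∃ y, (∃ᶠ n in atTop, τ n = y) ∧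
      ∀ x, Tendsto (empFreq τ x) atTop (𝓝 (cesaroPMF P y x).toReal) := by
  have hergodic := ae_all_iff.2 fun x =>
    ae_exists_tendsto_average ν P (Set.indicator {x} fun _ => 1)
  filter_upwards [hergodic] with τ hτ
  obtain ⟨y, hy⟩ : ∃ y, ∃ᶠ n in atTop, τ n = y := by
    by_contra! hnever
    obtain ⟨n, hn⟩ := (eventually_all.2 hnever).exists
    exact hn (τ n) rfl
  refine ⟨y, hy, fun x => ?_⟩
  obtain ⟨l, hproj, havg⟩ := hτ x
  have hl : harmonicProj P (Set.indicator {x} fun _ => 1) y = l :=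
    tendsto_nhds_unique_of_frequently_eq tendsto_const_nhds hproj
      (hy.mono fun n hn => by rw [hn])
  rw [toReal_cesaroPMF_apply, hl]
  unfold empFreq
  simpa only [one_div] using havg

lemma ae_tendsto_empFreq (ν : PMF X) (P : X → PMF X) :
    ∀ᵐ τ ∂(markovLaw ν P), ∀ x, Tendsto (empFreq τ x) atTop (𝓝 (empOcc τ x)) := by
  filter_upwards [ae_exists_tendsto_empFreq ν P] with τ ⟨y, _, hy⟩ x
  exact tendsto_nhds_limUnder ⟨_, hy x⟩

lemma ae_exists_empOcc_eq_cesaroPMF (ν : PMF X) (P : X → PMF X) :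
    ∀ᵐ τ ∂(markovLaw ν P), ∃ y, (∃ᶠ n in atTop, τ n = y) ∧
      ∀ x, empOcc τ x = (cesaroPMF P y x).toReal := by
  filter_upwards [ae_exists_tendsto_empFreq ν P] with τ ⟨y, hfreq, hy⟩
  exact ⟨y, hfreq, fun x => (hy x).limUnder_eq⟩

lemma aemeasurable_empOcc (ν : PMF X) (P : X → PMF X) (x : X) :
    AEMeasurable (fun τ => empOcc τ x) (markovLaw ν P) := by
  refine aemeasurable_of_tendsto_metrizable_ae atTop
    (fun H => (measurable_empFreq x H).aemeasurable) ?_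
  filter_upwards [ae_tendsto_empFreq ν P] with τ hτ using hτ x

lemma memLp_empOcc (ν : PMF X) (P : X → PMF X) (x : X) :
    MemLp (fun τ => empOcc τ x) 2 (markovLaw ν P) := by
  refine MemLp.of_bound (aemeasurable_empOcc ν P x).aestronglyMeasurable 1 ?_
  filter_upwards [ae_tendsto_empFreq ν P] with τ hτ
  rw [Real.norm_of_nonneg (ge_of_tendsto' (hτ x) (empFreq_nonneg τ x))]
  exact le_of_tendsto' (hτ x) (empFreq_le_one τ x)

lemma integrable_empOcc (ν : PMF X) (P : X → PMF X) (x : X) :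
    Integrable (fun τ => empOcc τ x) (markovLaw ν P) :=
  (memLp_empOcc ν P x).integrable one_le_two

lemma integral_empFreq (ν : PMF X) (P : X → PMF X) (x : X) (H : ℕ) :
    ∫ τ, empFreq τ x H ∂(markovLaw ν P) =
      (1 / (H : ℝ)) * ∑ t ∈ Finset.range H, (markovLaw ν P).real {τ | τ t = x} := by
  unfold empFreq
  rw [integral_const_mul, integral_finsetSum _ fun t _ =>
    integrable_comp_of_finite (Y := X) (measurable_pi_apply t) (Set.indicator {x} fun _ => 1)]
  refine congrArg _ (Finset.sum_congr rfl fun t _ => ?_)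
  exact integral_indicator_one (measurable_pi_apply t (measurableSet_singleton x))

lemma tendsto_integral_empFreq (ν : PMF X) (P : X → PMF X) (x : X) :
    Tendsto (fun H => ∫ τ, empFreq τ x H ∂(markovLaw ν P)) atTop
      (𝓝 (∫ τ, empOcc τ x ∂(markovLaw ν P))) := by
  refine tendsto_integral_of_dominated_convergence (fun _ => 1)
    (fun H => (measurable_empFreq x H).aestronglyMeasurable) (integrable_const _)
    (fun H => Eventually.of_forall fun τ => ?_) ?_
  · rw [Real.norm_of_nonneg (empFreq_nonneg τ x H)]
    exact empFreq_le_one τ x H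
  · filter_upwards [ae_tendsto_empFreq ν P] with τ hτ using hτ x

lemma tendsto_real_mem_of_isClosedUnder (ν : PMF X) {P : X → PMF X} {C : Set X}
    (hC : IsClosedUnder P C) :
    Tendsto (fun t => (markovLaw ν P).real {τ | τ t ∈ C}) atTop
      (𝓝 ((markovLaw ν P).real {τ | ∃ t, τ t ∈ C})) := by
  refine (ENNReal.tendsto_toReal (measure_ne_top _ _)).comp
    (tendsto_measure_of_ae_tendsto_indicator_of_isFiniteMeasure atTop
      (measurableSet_exists_mem C.toFinite.measurableSet)
      (fun t => measurable_pi_apply t C.toFinite.measurableSet) ?_)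
  filter_upwards [ae_mem_of_isClosedUnder ν hC] with τ hτ
  by_cases hhit : ∃ t, τ t ∈ C
  · obtain ⟨t, ht⟩ := hhit
    filter_upwards [eventually_ge_atTop t] with n hn
    exact iff_of_true (hτ t ht n hn) ⟨t, ht⟩
  · exact Eventually.of_forall fun n => iff_of_false (fun hn => hhit ⟨n, hn⟩) hhit

lemma ae_empOcc_eq_indicator (ν : PMF X) {P : X → PMF X} {C : Set X}
    (hC : IsClosedIrreducible P C) {μ : PMF X} (hμ : μ.bind P = μ) (hμC : μ.support ⊆ C) {x : X}
    (hx : x ∈ C) :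
    ∀ᵐ τ ∂(markovLaw ν P),
      empOcc τ x = Set.indicator {τ : ℕ → X | ∃ t, τ t ∈ C} (fun _ => (μ x).toReal) τ := by
  filter_upwards [ae_exists_empOcc_eq_cesaroPMF ν P, ae_mem_of_isClosedUnder ν hC.isClosedUnder]
    with τ ⟨y, hfreq, hy⟩ hmem
  by_cases hhit : ∃ t, τ t ∈ C
  · rw [Set.indicator_of_mem (s := {τ : ℕ → X | ∃ t, τ t ∈ C}) hhit]
    obtain ⟨t, ht⟩ := hhit
    obtain ⟨n, hn, rfl⟩ := frequently_atTop.1 hfreq t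
    rw [hy, hC.cesaroPMF_eq hμ hμC (hmem t ht n hn)]
  · rw [Set.indicator_of_notMem (s := {τ : ℕ → X | ∃ t, τ t ∈ C}) hhit]
    exact empOcc_eq_zero fun t ht => hhit ⟨t, ht ▸ hx⟩

end EmpiricalOccupancy

section JensenGap

variable {Ω E : Type*} [MeasurableSpace Ω] {ν : Measure Ω}

lemma variance_indicator_const [IsProbabilityMeasure ν] {B : Set Ω} (hB : MeasurableSet B) (b : ℝ) :
    variance (B.indicator fun _ => b) ν = ν.real B * (1 - ν.real B) * b ^ 2 := by
  have hsq : (B.indicator fun _ => b) ^ 2 = B.indicator fun _ => b ^ 2 :=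
    (Set.indicator_comp_of_zero (g := fun r : ℝ => r ^ 2) (zero_pow two_ne_zero)).symm
  rw [variance_eq_sub ((memLp_const b).indicator hB), hsq, integral_indicator_const _ hB,
    integral_indicator_const _ hB, smul_eq_mul, smul_eq_mul]
  ring

section FiniteRange

variable [IsFiniteMeasure ν] [MeasurableSpace E] [MeasurableSingletonClass E] {D : Ω → E}
  {F : Finset E}

lemma integrable_of_ae_mem_finset {G : Type*} [NormedAddCommGroup G] {m : Measure E}
    [IsFiniteMeasure m] (hF : ∀ᵐ d ∂m, d ∈ F) (φ : E → G) : Integrable φ m := by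
  rw [← Measure.restrict_eq_self_of_ae_mem hF]
  exact IntegrableOn.finset

lemma integrable_comp_of_ae_mem_finset {G : Type*} [NormedAddCommGroup G]
    (hD : AEMeasurable D ν) (hF : ∀ᵐ ω ∂ν, D ω ∈ F) (φ : E → G) :
    Integrable (fun ω => φ (D ω)) ν :=
  (integrable_of_ae_mem_finset ((ae_map_iff hD F.measurableSet).2 hF) φ).comp_aemeasurable hD

lemma integral_comp_of_ae_mem_finset {G : Type*} [NormedAddCommGroup G] [NormedSpace ℝ G]
    [CompleteSpace G] (hD : AEMeasurable D ν) (hF : ∀ᵐ ω ∂ν, D ω ∈ F) (φ : E → G) :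
    ∫ ω, φ (D ω) ∂ν = ∑ d ∈ F, (ν.map D).real {d} • φ d := by
  have hFmap : ∀ᵐ d ∂(ν.map D), d ∈ F := (ae_map_iff hD F.measurableSet).2 hF
  have hint := integrable_of_ae_mem_finset hFmap φ
  rw [← integral_map hD hint.aestronglyMeasurable, ← setIntegral_finset F hint.integrableOn,
    Measure.restrict_eq_self_of_ae_mem hFmap]

end FiniteRange

variable [IsProbabilityMeasure ν] {s : Set E} {f : E → ℝ} {D : Ω → E} {F : Finset E} {c : ℝ}

-- `ConvexOn.map_integral_le` would need `f` to be continuous, which may fail at the boundary of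
-- a simplex; for finitely many values no continuity is required.
lemma map_integral_le_of_convexOn_of_ae_mem_finset [NormedAddCommGroup E] [NormedSpace ℝ E]
    [CompleteSpace E] [MeasurableSpace E] [BorelSpace E] (hf : ConvexOn ℝ s f)
    (hD : AEMeasurable D ν) (hF : ∀ᵐ ω ∂ν, D ω ∈ F) (hFs : (F : Set E) ⊆ s) :
    f (∫ ω, D ω ∂ν) ≤ ∫ ω, f (D ω) ∂ν := by
  have hone : ∑ d ∈ F, (ν.map D).real {d} = 1 := by
    simpa using (integral_comp_of_ae_mem_finset hD hF fun _ => (1 : ℝ)).symm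
  rw [integral_comp_of_ae_mem_finset hD hF f, integral_comp_of_ae_mem_finset hD hF fun d => d]
  exact hf.map_sum_le (fun _ _ => measureReal_nonneg) hone hFs

lemma integral_norm_sq_sub_le_of_strongConvexOn [NormedAddCommGroup E] [InnerProductSpace ℝ E]
    [CompleteSpace E] [MeasurableSpace E] [BorelSpace E] (hf : StrongConvexOn s c f)
    (hD : AEMeasurable D ν) (hF : ∀ᵐ ω ∂ν, D ω ∈ F) (hFs : (F : Set E) ⊆ s) :
    c / 2 * (∫ ω, ‖D ω‖ ^ 2 ∂ν - ‖∫ ω, D ω ∂ν‖ ^ 2) ≤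
      ∫ ω, f (D ω) ∂ν - f (∫ ω, D ω ∂ν) := by
  have hint {φ : E → ℝ} : Integrable (fun ω => φ (D ω)) ν :=
    integrable_comp_of_ae_mem_finset hD hF φ
  have hjensen := map_integral_le_of_convexOn_of_ae_mem_finset
    (strongConvexOn_iff_convex.1 hf) hD hF hFs
  rw [integral_sub hint (hint (φ := fun d => c / 2 * ‖d‖ ^ 2)), integral_const_mul] at hjensen
  linarith

lemma sum_variance_le_of_strongConvexOn {Y : Type*} [Fintype Y] {s : Set (EuclideanSpace ℝ Y)}
    {f : EuclideanSpace ℝ Y → ℝ} {D : Ω → EuclideanSpace ℝ Y} {F : Finset (EuclideanSpace ℝ Y)}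
    (hf : StrongConvexOn s c f) (hD : AEMeasurable D ν) (hF : ∀ᵐ ω ∂ν, D ω ∈ F)
    (hFs : (F : Set (EuclideanSpace ℝ Y)) ⊆ s) :
    c / 2 * ∑ y, variance (fun ω => D ω y) ν ≤ ∫ ω, f (D ω) ∂ν - f (∫ ω, D ω ∂ν) := by
  have hint {φ : EuclideanSpace ℝ Y → ℝ} : Integrable (fun ω => φ (D ω)) ν :=
    integrable_comp_of_ae_mem_finset hD hF φ
  have hvar : ∀ y, variance (fun ω => D ω y) ν =
      ∫ ω, D ω y ^ 2 ∂ν - (∫ ω, D ω y ∂ν) ^ 2 := fun y =>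
    variance_eq_sub ((memLp_two_iff_integrable_sq
      (hint (φ := fun d => d y)).aestronglyMeasurable).2 (hint (φ := fun d => d y ^ 2)))
  have hmean : ∀ y, (∫ ω, D ω ∂ν) y = ∫ ω, D ω y ∂ν :=
    eval_integral_piLp fun y => hint (φ := fun d => d y)
  have hgap := integral_norm_sq_sub_le_of_strongConvexOn hf hD hF hFs
  simp only [EuclideanSpace.real_norm_sq_eq, hmean] at hgap
  rw [integral_finsetSum _ fun y _ => hint (φ := fun d => d y ^ 2)] at hgap
  simpa only [hvar, Finset.sum_sub_distrib] using hgap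

end JensenGap

section IndependentCopies

variable {ι Ω : Type*} [Fintype ι] [MeasurableSpace Ω] {ν : Measure Ω} [IsProbabilityMeasure ν]
  {Z : Ω → ℝ}

lemma integral_average_pi [Nonempty ι] (hZ : Integrable Z ν) :
    ∫ ω, 1 / (Fintype.card ι : ℝ) * ∑ i, Z (ω i) ∂(Measure.pi fun _ : ι => ν) =
      ∫ ω, Z ω ∂ν := by
  have hcopy : ∀ i, ∫ ω, Z (ω i) ∂(Measure.pi fun _ : ι => ν) = ∫ ω, Z ω ∂ν := fun i =>
    integral_comp_eval (μ := fun _ => ν) hZ.aestronglyMeasurable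
  rw [integral_const_mul, integral_finsetSum _ fun i _ =>
    integrable_comp_eval (μ := fun _ : ι => ν) (i := i) hZ]
  simp [hcopy]

lemma variance_average_pi (hZ : MemLp Z 2 ν) :
    variance (fun ω => 1 / (Fintype.card ι : ℝ) * ∑ i, Z (ω i)) (Measure.pi fun _ : ι => ν) =
      1 / (Fintype.card ι : ℝ) * variance Z ν := by
  have hsum := variance_sum_pi (μ := fun _ : ι => ν) (X := fun _ => Z) fun _ => hZ
  rw [Finset.sum_fn, Finset.sum_const, Finset.card_univ, nsmul_eq_mul] at hsum
  rw [variance_const_mul, hsum]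
  field_simp

end IndependentCopies

lemma average_pmf_mem_probSimplex {X : Type*} [Fintype X] {K : ℕ} (hK : 1 ≤ K)
    (p : Fin K → PMF X) :
    WithLp.toLp 2 (fun x => 1 / (K : ℝ) * ∑ k, (p k x).toReal) ∈ probSimplex X := by
  have hK' : (K : ℝ) ≠ 0 := by positivity
  refine ⟨fun x => by positivity, ?_⟩
  rw [← Finset.mul_sum, Finset.sum_comm]
  simp [sum_pmf_toReal, hK']

namespace GUMDP

section StateActionChain

variable {S A : Type*}

lemma withAction_apply (π : S → PMF A) (ν : PMF S) (s : S) (a : A) :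
    withAction π ν (s, a) = ν s * π s a := by
  classical
  rw [withAction, PMF.bind_apply, tsum_eq_single s fun s' hs' => ?_, PMF.map_apply,
    tsum_eq_single a fun a' ha' => ?_, if_pos rfl]
  · simp [ha'.symm]
  · simp [PMF.map_apply, hs'.symm]

lemma mem_support_withAction {π : S → PMF A} {ν : PMF S} {z : S × A} :
    z ∈ (withAction π ν).support ↔ z.1 ∈ ν.support ∧ z.2 ∈ (π z.1).support := by
  simp only [PMF.mem_support_iff, withAction_apply π ν z.1 z.2, mul_ne_zero_iff]

/-- The state-action pairs with state in `C` whose action the policy `π` plays with positive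
probability. -/
def playable (π : S → PMF A) (C : Set S) : Set (S × A) :=
  {z | z.1 ∈ C ∧ z.2 ∈ (π z.1).support}

variable [Fintype A]

/-- The expectation of `g (s, a)` over an action `a` drawn from `π(·|s)`, as a function of `s`. -/
def actionMean (π : S → PMF A) (g : S × A → ℝ) (s : S) : ℝ :=
  pmfMean (π s) fun a => g (s, a)

lemma actionMean_indicator_playable (π : S → PMF A) (C : Set S) :
    actionMean π (Set.indicator (playable π C) fun _ => 1) = Set.indicator C fun _ => 1 := by
  ext s
  by_cases hs : s ∈ C
  · rw [Set.indicator_of_mem hs]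
    exact pmfMean_eq_of_forall_eq fun a ha =>
      Set.indicator_of_mem (show (s, a) ∈ playable π C from ⟨hs, ha⟩) _
  · rw [Set.indicator_of_notMem hs]
    exact pmfMean_eq_of_forall_eq fun a _ => Set.indicator_of_notMem (fun hz => hs hz.1) _

variable [Fintype S]

lemma pmfMean_withAction (π : S → PMF A) (ν : PMF S) (g : S × A → ℝ) :
    pmfMean (withAction π ν) g = pmfMean ν (actionMean π g) := by
  simp only [withAction, pmfMean_bind, pmfMean_map]
  rfl

/-- The transition probabilities of the state-action chain of a stationary policy. -/
def pairKernel (M : GUMDP S A) (π : S → PMF A) (z : S × A) : PMF (S × A) :=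
  withAction π (M.trans z.1 z.2)

lemma actionMean_semiconj (M : GUMDP S A) (π : S → PMF A) :
    Function.Semiconj (actionMean π) (transOp (M.pairKernel π)) (transOp (M.policyKernel π)) := by
  intro g
  ext s
  simp only [actionMean, transOp_apply, pairKernel, pmfMean_withAction, policyKernel, pmfMean_bind]

lemma withAction_bind_pairKernel {M : GUMDP S A} {π : S → PMF A} {μ : PMF S}
    (hμ : μ.bind (M.policyKernel π) = μ) :
    (withAction π μ).bind (M.pairKernel π) = withAction π μ := by
  refine pmf_ext_of_pmfMean fun g => ?_
  calc pmfMean ((withAction π μ).bind (M.pairKernel π)) g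
      = pmfMean (withAction π μ) (transOp (M.pairKernel π) g) := pmfMean_bind _ _ _
    _ = pmfMean μ (transOp (M.policyKernel π) (actionMean π g)) := by
      rw [pmfMean_withAction, actionMean_semiconj]
    _ = pmfMean (withAction π μ) g := by
      rw [pmfMean_transOp_of_stationary hμ, pmfMean_withAction]

lemma mem_support_policyKernel {M : GUMDP S A} {π : S → PMF A} {s s' : S} :
    s' ∈ (M.policyKernel π s).support ↔ ∃ a ∈ (π s).support, s' ∈ (M.trans s a).support :=
  PMF.mem_support_bind_iff _ _ _

lemma exists_reaches_pairKernel {M : GUMDP S A} {π : S → PMF A} {s s' : S} {a' : A}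
    (hs : Reaches (M.policyKernel π) s s') (ha' : a' ∈ (π s').support) :
    ∃ a ∈ (π s).support, Reaches (M.pairKernel π) (s, a) (s', a') := by
  induction hs using Relation.ReflTransGen.head_induction_on with
  | refl => exact ⟨a', ha', .refl⟩
  | head hstep _ ih =>
    obtain ⟨b, hb, hreach⟩ := ih
    obtain ⟨a, ha, htrans⟩ := mem_support_policyKernel.1 hstep
    exact ⟨a, ha, .head (mem_support_withAction.2 ⟨htrans, hb⟩) hreach⟩

lemma isClosedUnder_playable {M : GUMDP S A} {π : S → PMF A} {C : Set S}
    (hC : IsClosedUnder (M.policyKernel π) C) :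
    IsClosedUnder (M.pairKernel π) (playable π C) := by
  intro z hz z' hz'
  obtain ⟨htrans, haction⟩ := mem_support_withAction.1 hz'
  exact ⟨hC z.1 hz.1 (mem_support_policyKernel.2 ⟨z.2, hz.2, htrans⟩), haction⟩

lemma isClosedIrreducible_playable {M : GUMDP S A} {π : S → PMF A} {C : Set S}
    (hC : IsClosedIrreducible (M.policyKernel π) C) :
    IsClosedIrreducible (M.pairKernel π) (playable π C) where
  isClosedUnder := isClosedUnder_playable hC.isClosedUnder
  reaches z hz z' hz' := by
    obtain ⟨s, hs⟩ := (M.trans z.1 z.2).support_nonempty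
    have hsC := hC.isClosedUnder z.1 hz.1 (mem_support_policyKernel.2 ⟨z.2, hz.2, hs⟩)
    obtain ⟨a, ha, hreach⟩ := exists_reaches_pairKernel (hC.reaches s hsC z'.1 hz'.1) hz'.2
    exact .head (mem_support_withAction.2 ⟨hs, ha⟩) hreach

end StateActionChain

section Occupancy

variable {S A : Type*} [Fintype S] [Fintype A] [MeasurableSpace S] [MeasurableSingletonClass S]
  [MeasurableSpace A] [MeasurableSingletonClass A]

instance instIsProbabilityMeasureTrajLaw (M : GUMDP S A) (π : S → PMF A) :
    IsProbabilityMeasure (M.trajLaw π) :=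
  instIsProbabilityMeasureMarkovLaw _ _

instance instIsProbabilityMeasureTrialsLaw (M : GUMDP S A) (π : S → PMF A) (K : ℕ) :
    IsProbabilityMeasure (M.trialsLaw π K) :=
  inferInstanceAs (IsProbabilityMeasure (Measure.pi fun _ => M.trajLaw π))

lemma integral_trajLaw (M : GUMDP S A) (π : S → PMF A) (g : S × A → ℝ) (t : ℕ) :
    ∫ τ, g (τ t) ∂(M.trajLaw π) =
      ∫ ω, actionMean π g (ω t) ∂(markovLaw M.init (M.policyKernel π)) := by
  rw [integral_markovLaw_eq_iterate, ← (actionMean_semiconj M π).iterate_right t g,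
    ← pmfMean_withAction]
  exact integral_markovLaw_eq_iterate _ (M.pairKernel π) g t

lemma probIn_eq_real_trajLaw (M : GUMDP S A) (π : S → PMF A) (R : Finset S) (t : ℕ) :
    probIn M.init (M.policyKernel π) R t = (M.trajLaw π).real {τ | τ t ∈ playable π R} := by
  have hpair := integral_trajLaw M π (Set.indicator (playable π R) fun _ => 1) t
  rw [actionMean_indicator_playable] at hpair
  exact ((integral_indicator_one (measurable_pi_apply t R.measurableSet)).symm.trans
    hpair.symm).trans (integral_indicator_one
      (measurable_pi_apply t (playable π R).toFinite.measurableSet))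

lemma tendsto_probIn {M : GUMDP S A} {π : S → PMF A} {R : Finset S}
    (hR : IsClosedUnder (M.policyKernel π) R) :
    Tendsto (probIn M.init (M.policyKernel π) R) atTop
      (𝓝 ((M.trajLaw π).real {τ | ∃ t, τ t ∈ playable π R})) := by
  rw [funext (probIn_eq_real_trajLaw M π R)]
  exact tendsto_real_mem_of_isClosedUnder _ (isClosedUnder_playable hR)

lemma absorptionProb_eq {M : GUMDP S A} {π : S → PMF A} {R : Finset S}
    (hR : IsClosedUnder (M.policyKernel π) R) :
    absorptionProb M.init (M.policyKernel π) R =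
      (M.trajLaw π).real {τ | ∃ t, τ t ∈ playable π R} :=
  (tendsto_probIn hR).limUnder_eq

lemma tendsto_probIn_absorptionProb {M : GUMDP S A} {π : S → PMF A} {R : Finset S}
    (hR : IsClosedUnder (M.policyKernel π) R) :
    Tendsto (probIn M.init (M.policyKernel π) R) atTop
      (𝓝 (absorptionProb M.init (M.policyKernel π) R)) :=
  tendsto_nhds_limUnder ⟨_, tendsto_probIn hR⟩

lemma variance_empOcc {M : GUMDP S A} {π : S → PMF A} {R : Finset S} {μ : PMF S}
    (hR : IsClosedIrreducible (M.policyKernel π) R)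
    (hμ : IsStationaryOn (M.policyKernel π) R μ) {s : S} (hs : s ∈ R) {a : A}
    (ha : a ∈ (π s).support) :
    variance (fun τ => empOcc τ (s, a)) (M.trajLaw π) =
      absorptionProb M.init (M.policyKernel π) R *
        (1 - absorptionProb M.init (M.policyKernel π) R) *
        ((π s a).toReal ^ 2 * (μ s).toReal ^ 2) := by
  have hsupport : (withAction π μ).support ⊆ playable π R := fun z hz =>
    ⟨hμ.support_subset (mem_support_withAction.1 hz).1, (mem_support_withAction.1 hz).2⟩
  have hocc := ae_empOcc_eq_indicator (withAction π M.init) (isClosedIrreducible_playable hR)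
    (withAction_bind_pairKernel hμ.1) hsupport (show (s, a) ∈ playable π R from ⟨hs, ha⟩)
  rw [absorptionProb_eq hR.isClosedUnder, ← mul_pow, mul_comm (π s a).toReal,
    ← ENNReal.toReal_mul, ← withAction_apply]
  exact (variance_congr hocc).trans (variance_indicator_const
    (measurableSet_exists_mem (playable π R).toFinite.measurableSet) _)

lemma tendsto_expFreq (M : GUMDP S A) (π : S → PMF A) (z : S × A) :
    Tendsto (M.expFreq π z) atTop (𝓝 (∫ τ, empOcc τ z ∂(M.trajLaw π))) :=
  (tendsto_integral_empFreq _ (M.pairKernel π) z).congr (integral_empFreq _ (M.pairKernel π) z)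

lemma avgOcc_apply (M : GUMDP S A) (π : S → PMF A) (z : S × A) :
    M.avgOcc π z = ∫ τ, empOcc τ z ∂(M.trajLaw π) :=
  (M.tendsto_expFreq π z).limUnder_eq

lemma tendsto_expFreq_avgOcc (M : GUMDP S A) (π : S → PMF A) (z : S × A) :
    Tendsto (M.expFreq π z) atTop (𝓝 (M.avgOcc π z)) :=
  tendsto_nhds_limUnder ⟨_, M.tendsto_expFreq π z⟩

lemma sum_le_sum_variance_empOcc (M : GUMDP S A) (π : S → PMF A) {μ : Finset S → PMF S}
    (hμ : ∀ R ∈ recurrentClasses (M.policyKernel π),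
      IsStationaryOn (M.policyKernel π) R (μ R)) :
    ∑ R ∈ recurrentClasses (M.policyKernel π),
      absorptionProb M.init (M.policyKernel π) R *
        (1 - absorptionProb M.init (M.policyKernel π) R) *
        ∑ s ∈ R, ∑ a, (π s a).toReal ^ 2 * (μ R s).toReal ^ 2 ≤
    ∑ z, variance (fun τ => empOcc τ z) (M.trajLaw π) := by
  classical
  set V : S → A → ℝ := fun s a => variance (fun τ => empOcc τ (s, a)) (M.trajLaw π)
  have hV : ∀ s a, 0 ≤ V s a := fun s a => variance_nonneg _ _
  have hrec : ∀ R ∈ recurrentClasses (M.policyKernel π), IsRecurrentClass (M.policyKernel π) R :=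
    fun _ => isRecurrentClass_of_mem_recurrentClasses
  have hdisj : Set.PairwiseDisjoint (recurrentClasses (M.policyKernel π) : Set (Finset S)) id :=
    fun R hR R' hR' hne => Finset.disjoint_left.2 fun s hs hs' =>
      hne ((hrec R hR).eq_of_mem (hrec R' hR') hs hs')
  calc _ ≤ ∑ R ∈ recurrentClasses (M.policyKernel π), ∑ s ∈ R, ∑ a, V s a := by
        refine Finset.sum_le_sum fun R hR => ?_
        simp only [Finset.mul_sum]
        refine Finset.sum_le_sum fun s hs => Finset.sum_le_sum fun a _ => ?_
        by_cases ha : π s a = 0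
        · simpa [ha] using hV s a
        · exact (variance_empOcc (hrec R hR).isClosedIrreducible (hμ R hR) hs ha).ge
    _ = ∑ s ∈ (recurrentClasses (M.policyKernel π)).biUnion id, ∑ a, V s a :=
        (Finset.sum_biUnion hdisj).symm
    _ ≤ ∑ s, ∑ a, V s a :=
        Finset.sum_le_sum_of_subset_of_nonneg (Finset.subset_univ _) fun s _ _ =>
          Finset.sum_nonneg fun a _ => hV s a
    _ = _ := (Fintype.sum_prod_type
        fun z : S × A => variance (fun τ => empOcc τ z) (M.trajLaw π)).symm

lemma variance_empOccTrials (M : GUMDP S A) (π : S → PMF A) (K : ℕ) (z : S × A) :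
    variance (fun T => empOccTrials T z) (M.trialsLaw π K) =
      1 / (K : ℝ) * variance (fun τ => empOcc τ z) (M.trajLaw π) := by
  have havg := variance_average_pi (ι := Fin K) (memLp_empOcc (withAction π M.init)
    (M.pairKernel π) z)
  rwa [Fintype.card_fin] at havg

lemma aemeasurable_empOccTrials (M : GUMDP S A) (π : S → PMF A) (K : ℕ) :
    AEMeasurable (fun T : Fin K → ℕ → S × A => empOccTrials T) (M.trialsLaw π K) := by
  refine (WithLp.measurable_toLp 2 _).comp_aemeasurable (aemeasurable_pi_lambda _ fun z => ?_)
  refine AEMeasurable.const_mul (Finset.aemeasurable_fun_sum _ fun k _ => ?_) _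
  exact (aemeasurable_empOcc _ (M.pairKernel π) z).comp_quasiMeasurePreserving
    (Measure.quasiMeasurePreserving_eval (fun _ => M.trajLaw π) k)

lemma exists_finset_ae_empOccTrials_mem (M : GUMDP S A) (π : S → PMF A) {K : ℕ} (hK : 1 ≤ K) :
    ∃ F : Finset (EuclideanSpace ℝ (S × A)), (F : Set _) ⊆ probSimplex (S × A) ∧
      ∀ᵐ T ∂(M.trialsLaw π K), empOccTrials T ∈ F := by
  classical
  set rowAverage : (Fin K → S × A) → EuclideanSpace ℝ (S × A) := fun y => WithLp.toLp 2 fun z =>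
    (1 / (K : ℝ)) * ∑ k, (cesaroPMF (M.pairKernel π) (y k) z).toReal
  refine ⟨Finset.univ.image rowAverage, ?_, ?_⟩
  · rw [Finset.coe_image, Finset.coe_univ, Set.image_univ, Set.range_subset_iff]
    exact fun y => average_pmf_mem_probSimplex hK fun k => cesaroPMF (M.pairKernel π) (y k)
  · have hrow : ∀ᵐ τ ∂(M.trajLaw π), ∃ y, ∀ z,
        empOcc τ z = (cesaroPMF (M.pairKernel π) y z).toReal :=
      (ae_exists_empOcc_eq_cesaroPMF (withAction π M.init) (M.pairKernel π)).mono
        fun _ ⟨y, _, hy⟩ => ⟨y, hy⟩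
    have hrows : ∀ᵐ T ∂(M.trialsLaw π K), ∀ k, ∃ y, ∀ z,
        empOcc (T k) z = (cesaroPMF (M.pairKernel π) y z).toReal := ae_all_iff.2 fun k =>
      (Measure.quasiMeasurePreserving_eval (fun _ => M.trajLaw π) k).ae hrow
    filter_upwards [hrows] with T hT
    choose y hy using hT
    refine Finset.mem_image.2 ⟨y, Finset.mem_univ y, ?_⟩
    simp only [rowAverage, empOccTrials, hy]

lemma integrable_utility_empOccTrials (M : GUMDP S A) (π : S → PMF A) {K : ℕ} (hK : 1 ≤ K) :
    Integrable (fun T => M.utility (empOccTrials T)) (M.trialsLaw π K) := by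
  obtain ⟨F, -, hF⟩ := M.exists_finset_ae_empOccTrials_mem π hK
  exact integrable_comp_of_ae_mem_finset (M.aemeasurable_empOccTrials π K) hF M.utility

lemma integral_empOccTrials (M : GUMDP S A) (π : S → PMF A) {K : ℕ} (hK : 1 ≤ K) :
    ∫ T, empOccTrials T ∂(M.trialsLaw π K) = M.avgOcc π := by
  have : Nonempty (Fin K) := Fin.pos_iff_nonempty.1 hK
  obtain ⟨F, -, hF⟩ := M.exists_finset_ae_empOccTrials_mem π hK
  ext z
  rw [eval_integral_piLp fun z =>
    integrable_comp_of_ae_mem_finset (M.aemeasurable_empOccTrials π K) hF fun d => d z,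
    avgOcc_apply]
  have havg := integral_average_pi (ι := Fin K) (integrable_empOcc (withAction π M.init)
    (M.pairKernel π) z)
  rwa [Fintype.card_fin] at havg

lemma sum_variance_le_finiteTrials_sub_infiniteTrials (M : GUMDP S A) (π : S → PMF A) {c : ℝ}
    (hf : StrongConvexOn (probSimplex (S × A)) c M.utility) {K : ℕ} (hK : 1 ≤ K) :
    c / (2 * (K : ℝ)) * ∑ z, variance (fun τ => empOcc τ z) (M.trajLaw π) ≤
      M.finiteTrials π K - M.infiniteTrials π := by
  obtain ⟨F, hFs, hF⟩ := M.exists_finset_ae_empOccTrials_mem π hK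
  have hgap := sum_variance_le_of_strongConvexOn hf (M.aemeasurable_empOccTrials π K) hF hFs
  rw [M.integral_empOccTrials π hK] at hgap
  simp only [variance_empOccTrials, ← Finset.mul_sum] at hgap
  rwa [← mul_assoc, div_mul_div_comm, mul_one] at hgap

end Occupancy

end GUMDP

end

theorem theorem6 {S A : Type*} [Fintype S] [Fintype A]
    [MeasurableSpace S] [MeasurableSingletonClass S]
    [MeasurableSpace A] [MeasurableSingletonClass A]
    (M : GUMDP S A) (c : ℝ) (hc : 0 < c)
    (hf : StrongConvexOn (probSimplex (S × A)) c M.utility)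
    (K : ℕ) (hK : 1 ≤ K) (π : S → PMF A) :
    -- every recurrent class carries exactly one stationary distribution
    (∀ R ∈ recurrentClasses (M.policyKernel π),
      ∃! μ : PMF S, IsStationaryOn (M.policyKernel π) R μ) ∧
    -- the limits and the expectation in the definitions exist
    (∀ R ∈ recurrentClasses (M.policyKernel π),
      Tendsto (probIn M.init (M.policyKernel π) R) atTop
        (𝓝 (absorptionProb M.init (M.policyKernel π) R))) ∧
    (∀ x, Tendsto (M.expFreq π x) atTop (𝓝 (M.avgOcc π x))) ∧
    (∀ᵐ τ ∂(M.trajLaw π), ∀ x, Tendsto (empFreq τ x) atTop (𝓝 (empOcc τ x))) ∧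
    Integrable (fun T => M.utility (empOccTrials T)) (M.trialsLaw π K) ∧
    -- the lower bound
    ∀ μ : Finset S → PMF S,
      (∀ R ∈ recurrentClasses (M.policyKernel π),
        IsStationaryOn (M.policyKernel π) R (μ R)) →
      M.finiteTrials π K - M.infiniteTrials π ≥
        c / (2 * (K : ℝ)) * ∑ R ∈ recurrentClasses (M.policyKernel π),
          absorptionProb M.init (M.policyKernel π) R *
            (1 - absorptionProb M.init (M.policyKernel π) R) *
            ∑ s ∈ R, ∑ a, (π s a).toReal ^ 2 * (μ R s).toReal ^ 2 := by
  have hclosed : ∀ R ∈ recurrentClasses (M.policyKernel π),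
      IsClosedIrreducible (M.policyKernel π) (R : Set S) :=
    fun R hR => (isRecurrentClass_of_mem_recurrentClasses hR).isClosedIrreducible
  refine ⟨fun R hR => (hclosed R hR).existsUnique_isStationaryOn
      (isRecurrentClass_of_mem_recurrentClasses hR).nonempty,
    fun R hR => GUMDP.tendsto_probIn_absorptionProb (hclosed R hR).isClosedUnder,
    M.tendsto_expFreq_avgOcc π, ae_tendsto_empFreq (GUMDP.withAction π M.init) (M.pairKernel π),
    M.integrable_utility_empOccTrials π hK, fun μ hμ => ?_⟩
  calc _ ≤ c / (2 * (K : ℝ)) * ∑ z, variance (fun τ => empOcc τ z) (M.trajLaw π) := by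
        gcongr
        exact M.sum_le_sum_variance_empOcc π hμ
    _ ≤ _ := M.sum_variance_le_finiteTrials_sub_infiniteTrials π hf hK
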